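/- Let $n\ge 3$. Let $\mathcal{Z}^n_s$ be the class of $o$-symmetric zonoids in $\mathbb{R}^n$, i.e., the nonempty compact convex sets $K\subset\mathbb{R}^n$ with $-K=K$ that are limits in the Hausdorff metric of zonotopes (finite Minkowski sums of line segments); members of $\mathcal{Z}^n_s$ need not have interior points. Let $*:(\mathcal{Z}^n_s)^2\to\mathcal{Z}^n_s$ be an arbitrary map. Then the following are equivalent: (i) $*$ is projection covariant, i.e., $(K*L)|S=(K|S)*(L|S)$ for all $K,L\in\mathcal{Z}^n_s$ and every linear subspace $S$ of $\mathbb{R}^n$ with $1\le\dim S\le n-1$, where $X|S$ is the orthogonal projection of $X$ onto $S$; (ii) $*$ is continuous in the Hausdorff metric (jointly in both arguments) and $GL(n)$ covariant, i.e., $\phi(K*L)=(\phi K)*(\phi L)$ for all $K,L\in\mathcal{Z}^n_s$ and $\phi\in GL(n)$; (iii) there are real numbers $a,b\ge 0$ such that $K*L=aK+bL$ for all $K,L\in\mathcal{Z}^n_s$, where $+$ is Minkowski addition and $tX=\{tx:x\in X\}$. -/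

import Mathlib

open scoped Pointwise

/-- Euclidean `n`-space. -/
abbrev E (n : ℕ) := EuclideanSpace ℝ (Fin n)

/-- The line segment `[x, y]`, as a nonempty compact convex set. -/
noncomputable def segmentBody {n : ℕ} (x y : E n) : ConvexBody (E n) where
  carrier := segment ℝ x y
  convex' := convex_segment x y
  isCompact' := by
    rw [segment_eq_image_lineMap]
    exact isCompact_Icc.image AffineMap.lineMap_continuous
  nonempty' := ⟨x, left_mem_segment ℝ x y⟩

/-- A zonotope is a finite Minkowski sum of line segments. -/
def IsZonotope {n : ℕ} (K : ConvexBody (E n)) : Prop :=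
  ∃ (m : ℕ) (x y : Fin m → E n), K = ∑ i, segmentBody (x i) (y i)

/-- A zonoid is a limit of zonotopes; the metric on `ConvexBody` is the Hausdorff metric. -/
def IsZonoid {n : ℕ} (K : ConvexBody (E n)) : Prop :=
  K ∈ closure {Z : ConvexBody (E n) | IsZonotope Z}

/-- Central symmetry with respect to the origin. -/
def IsOSymm {n : ℕ} (K : ConvexBody (E n)) : Prop :=
  -(K : Set (E n)) = K

/-- The `o`-symmetric zonoids in `ℝⁿ`, with the Hausdorff metric inherited from `ConvexBody`. -/
abbrev SymmZonoid (n : ℕ) := {K : ConvexBody (E n) // IsZonoid K ∧ IsOSymm K}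

/-- The image of a nonempty compact convex set under a linear map. -/
def bodyMap {n : ℕ} (f : E n →ₗ[ℝ] E n) (K : ConvexBody (E n)) : ConvexBody (E n) where
  carrier := f '' K
  convex' := K.convex.linear_image f
  isCompact' := K.isCompact.image f.continuous_of_finiteDimensional
  nonempty' := K.nonempty.image f

theorem coe_bodyMap {n : ℕ} (f : E n →ₗ[ℝ] E n) (K : ConvexBody (E n)) :
    (bodyMap f K : Set (E n)) = f '' K := rfl

theorem continuous_bodyMap {n : ℕ} (f : E n →ₗ[ℝ] E n) : Continuous (bodyMap f) := by
  have hf : ∀ x y, dist (f x) (f y) ≤ ‖LinearMap.toContinuousLinearMap f‖ * dist x y := by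
    intro x y
    rw [dist_eq_norm, dist_eq_norm, ← map_sub]
    exact (LinearMap.toContinuousLinearMap f).le_opNorm (x - y)
  have key : ∀ A B : ConvexBody (E n), ∀ p ∈ (bodyMap f A : Set (E n)),
      ∃ q ∈ (bodyMap f B : Set (E n)),
        dist p q ≤ ‖LinearMap.toContinuousLinearMap f‖ * dist A B := by
    rintro A B _ ⟨x, hx, rfl⟩
    obtain ⟨y, hy, hxy⟩ := B.isCompact.exists_infDist_eq_dist B.nonempty x
    refine ⟨f y, ⟨y, hy, rfl⟩, (hf x y).trans ?_⟩
    refine mul_le_mul_of_nonneg_left ?_ (norm_nonneg _)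
    rw [← hxy]
    exact Metric.infDist_le_hausdorffDist_of_mem hx ConvexBody.hausdorffEDist_ne_top
  refine (LipschitzWith.of_dist_le_mul (K := ‖LinearMap.toContinuousLinearMap f‖₊) ?_).continuous
  intro A B
  refine Metric.hausdorffDist_le_of_mem_dist (by positivity) (key A B) ?_
  intro p hp
  rw [dist_comm A B]
  exact key B A p hp

theorem bodyMap_segmentBody {n : ℕ} (f : E n →ₗ[ℝ] E n) (x y : E n) :
    bodyMap f (segmentBody x y) = segmentBody (f x) (f y) :=
  ConvexBody.ext (image_segment ℝ f.toAffineMap x y)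

theorem bodyMap_add {n : ℕ} (f : E n →ₗ[ℝ] E n) (K L : ConvexBody (E n)) :
    bodyMap f (K + L) = bodyMap f K + bodyMap f L :=
  ConvexBody.ext (Set.image_add f)

theorem bodyMap_zero {n : ℕ} (f : E n →ₗ[ℝ] E n) : bodyMap f (0 : ConvexBody (E n)) = 0 :=
  ConvexBody.ext (by simp [coe_bodyMap, ← Set.singleton_zero])

theorem IsZonotope.bodyMap {n : ℕ} (f : E n →ₗ[ℝ] E n) {K : ConvexBody (E n)}
    (hK : IsZonotope K) : IsZonotope (bodyMap f K) := by
  obtain ⟨m, x, y, rfl⟩ := hK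
  refine ⟨m, fun i => f (x i), fun i => f (y i), ?_⟩
  simp only [← bodyMap_segmentBody]
  exact map_sum (⟨⟨_root_.bodyMap f, bodyMap_zero f⟩, bodyMap_add f⟩ :
    ConvexBody (E n) →+ ConvexBody (E n)) _ _

theorem IsZonoid.bodyMap {n : ℕ} (f : E n →ₗ[ℝ] E n) {K : ConvexBody (E n)}
    (hK : IsZonoid K) : IsZonoid (bodyMap f K) :=
  map_mem_closure (continuous_bodyMap f) hK fun _ hZ => IsZonotope.bodyMap f hZ

theorem IsOSymm.bodyMap {n : ℕ} (f : E n →ₗ[ℝ] E n) {K : ConvexBody (E n)}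
    (hK : IsOSymm K) : IsOSymm (bodyMap f K) := by
  unfold IsOSymm at *
  rw [coe_bodyMap, ← Set.image_neg f, hK]

/-- The image of an `o`-symmetric zonoid under a linear map. -/
def SymmZonoid.map {n : ℕ} (f : E n →ₗ[ℝ] E n) (K : SymmZonoid n) : SymmZonoid n :=
  ⟨bodyMap f K.1, IsZonoid.bodyMap f K.2.1, IsOSymm.bodyMap f K.2.2⟩

/-- The orthogonal projection `K | S` of an `o`-symmetric zonoid onto a subspace. -/
noncomputable def SymmZonoid.proj {n : ℕ} (S : Submodule ℝ (E n)) (K : SymmZonoid n) :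
    SymmZonoid n :=
  SymmZonoid.map (S.starProjection : E n →ₗ[ℝ] E n) K

/-- Projection covariance: `(K * L) | S = (K | S) * (L | S)` for all subspaces `S` of
dimension `1 ≤ k ≤ n - 1`. -/
def ProjectionCovariant {n : ℕ} (op : SymmZonoid n → SymmZonoid n → SymmZonoid n) : Prop :=
  ∀ S : Submodule ℝ (E n), 1 ≤ Module.finrank ℝ S → Module.finrank ℝ S < n →
    ∀ K L : SymmZonoid n,
      SymmZonoid.proj S (op K L) = op (SymmZonoid.proj S K) (SymmZonoid.proj S L)

/-- `GL(n)` covariance: `φ (K * L) = φ K * φ L` for all invertible linear maps `φ`. -/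
def GLCovariant {n : ℕ} (op : SymmZonoid n → SymmZonoid n → SymmZonoid n) : Prop :=
  ∀ φ : E n ≃ₗ[ℝ] E n, ∀ K L : SymmZonoid n,
    SymmZonoid.map (φ : E n →ₗ[ℝ] E n) (op K L) =
      op (SymmZonoid.map (φ : E n →ₗ[ℝ] E n) K) (SymmZonoid.map (φ : E n →ₗ[ℝ] E n) L)

/-- Joint continuity in the Hausdorff metric. -/
def HausdorffContinuous {n : ℕ} (op : SymmZonoid n → SymmZonoid n → SymmZonoid n) : Prop :=
  Continuous fun p : SymmZonoid n × SymmZonoid n => op p.1 p.2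

/-- The support function of a convex body. -/
noncomputable def supportFn {n : ℕ} (K : ConvexBody (E n)) (x : E n) : ℝ :=
  sSup ((fun y => inner ℝ x y) '' (K : Set (E n)))

theorem bddAbove_inner_image {n : ℕ} (K : ConvexBody (E n)) (x : E n) :
    BddAbove ((fun y => inner ℝ x y) '' (K : Set (E n))) :=
  (K.isCompact.image (by fun_prop)).bddAbove

theorem inner_le_supportFn {n : ℕ} {K : ConvexBody (E n)} {y : E n} (hy : y ∈ (K : Set (E n)))
    (x : E n) : inner ℝ x y ≤ supportFn K x :=
  le_csSup (bddAbove_inner_image K x) ⟨y, hy, rfl⟩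

theorem exists_inner_eq_supportFn {n : ℕ} (K : ConvexBody (E n)) (x : E n) :
    ∃ y ∈ (K : Set (E n)), inner ℝ x y = supportFn K x :=
  (K.isCompact.image (by fun_prop)).sSup_mem (K.nonempty.image _)

theorem supportFn_le {n : ℕ} {K : ConvexBody (E n)} {x : E n} {r : ℝ}
    (h : ∀ y ∈ (K : Set (E n)), inner ℝ x y ≤ r) : supportFn K x ≤ r := by
  obtain ⟨y, hy, e⟩ := exists_inner_eq_supportFn K x
  exact e ▸ h y hy

/-- Separating functionals are nonzero, so x = 0 can be omitted; covariance under projection to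
lines says nothing there. -/
theorem supportFn_injective {n : ℕ} {K L : ConvexBody (E n)}
    (h : ∀ x, x ≠ 0 → supportFn K x = supportFn L x) : K = L := by
  have key : ∀ K L : ConvexBody (E n), (∀ x, x ≠ 0 → supportFn K x = supportFn L x) →
      (K : Set (E n)) ⊆ L := by
    intro K L h y hy
    by_contra hyL
    obtain ⟨f, r, hf, hr⟩ := geometric_hahn_banach_closed_point L.convex L.isClosed hyL
    set x := (InnerProductSpace.toDual ℝ (E n)).symm f with hx
    have hfx : ∀ z, f z = inner ℝ x z := fun z => by simp [hx]
    have hx0 : x ≠ 0 := by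
      intro h0
      obtain ⟨z, hz⟩ := L.nonempty
      have := hf z hz
      simp only [hfx, h0, inner_zero_left] at this hr
      linarith
    have h1 := inner_le_supportFn hy x
    have h2 : supportFn L x ≤ r := supportFn_le fun z hz => (hfx z ▸ hf z hz).le
    rw [h x hx0] at h1
    rw [hfx] at hr
    linarith
  exact ConvexBody.ext ((key K L h).antisymm (key L K fun x hx => (h x hx).symm))

theorem supportFn_starProjection {n : ℕ} (S : Submodule ℝ (E n)) (K : SymmZonoid n) (x : E n) :
    supportFn (SymmZonoid.proj S K).1 x = supportFn K.1 (S.starProjection x) := by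
  simp only [supportFn, SymmZonoid.proj, SymmZonoid.map, coe_bodyMap, Set.image_image]
  congr 1
  refine Set.image_congr fun y _ => ?_
  exact (Submodule.inner_starProjection_left_eq_right S x y).symm

theorem supportFn_add {n : ℕ} (K L : ConvexBody (E n)) (x : E n) :
    supportFn (K + L) x = supportFn K x + supportFn L x := by
  apply le_antisymm
  · refine supportFn_le ?_
    rintro _ ⟨y, hy, z, hz, rfl⟩
    simp only [inner_add_right]
    exact add_le_add (inner_le_supportFn hy x) (inner_le_supportFn hz x)
  · obtain ⟨y, hy, e⟩ := exists_inner_eq_supportFn K x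
    obtain ⟨z, hz, e'⟩ := exists_inner_eq_supportFn L x
    rw [← e, ← e', ← inner_add_right]
    exact inner_le_supportFn (K := K + L) (Set.add_mem_add hy hz) x

theorem supportFn_smul_body {n : ℕ} {c : ℝ} (hc : 0 ≤ c) (K : ConvexBody (E n)) (x : E n) :
    supportFn (c • K) x = c * supportFn K x := by
  apply le_antisymm
  · refine supportFn_le ?_
    rintro _ ⟨y, hy, rfl⟩
    simp only [inner_smul_right]
    exact mul_le_mul_of_nonneg_left (inner_le_supportFn hy x) hc
  · obtain ⟨y, hy, e⟩ := exists_inner_eq_supportFn K x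
    rw [← e, ← inner_smul_right]
    exact inner_le_supportFn (K := c • K) (Set.smul_mem_smul_set hy) x

theorem supportFn_zero {n : ℕ} (x : E n) : supportFn (0 : ConvexBody (E n)) x = 0 := by
  simp [supportFn]

theorem supportFn_segmentBody {n : ℕ} (y z x : E n) :
    supportFn (segmentBody y z) x = max (inner ℝ x y) (inner ℝ x z) := by
  apply le_antisymm
  · refine supportFn_le ?_
    rintro _ ⟨a, b, ha, hb, hab, rfl⟩
    simp only [inner_add_right, inner_smul_right]
    calc _ ≤ a * max (inner ℝ x y) (inner ℝ x z) + b * max (inner ℝ x y) (inner ℝ x z) := by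
          gcongr
          exacts [le_max_left _ _, le_max_right _ _]
      _ = _ := by rw [← add_mul, hab, one_mul]
  · exact max_le (inner_le_supportFn (left_mem_segment ℝ y z) x)
      (inner_le_supportFn (right_mem_segment ℝ y z) x)

theorem supportFn_smul {n : ℕ} (K : ConvexBody (E n)) {c : ℝ} (hc : 0 ≤ c) (x : E n) :
    supportFn K (c • x) = c * supportFn K x := by
  apply le_antisymm
  · refine supportFn_le fun y hy => ?_
    rw [real_inner_smul_left]
    exact mul_le_mul_of_nonneg_left (inner_le_supportFn hy x) hc
  · obtain ⟨y, hy, e⟩ := exists_inner_eq_supportFn K x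
    rw [← e, ← real_inner_smul_left]
    exact inner_le_supportFn hy _

theorem supportFn_add_le {n : ℕ} (K : ConvexBody (E n)) (x y : E n) :
    supportFn K (x + y) ≤ supportFn K x + supportFn K y := by
  refine supportFn_le fun z hz => ?_
  rw [inner_add_left]
  exact add_le_add (inner_le_supportFn hz x) (inner_le_supportFn hz y)

theorem supportFn_le_add_dist {n : ℕ} (K L : ConvexBody (E n)) (x : E n) :
    supportFn K x ≤ supportFn L x + ‖x‖ * dist K L := by
  refine supportFn_le fun y hy => ?_
  obtain ⟨z, hz, hyz⟩ := L.isCompact.exists_infDist_eq_dist L.nonempty y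
  have h1 : dist y z ≤ dist K L := by
    rw [← hyz]
    exact Metric.infDist_le_hausdorffDist_of_mem hy ConvexBody.hausdorffEDist_ne_top
  have h2 : inner ℝ x (y - z) ≤ ‖x‖ * ‖y - z‖ := real_inner_le_norm _ _
  rw [← dist_eq_norm] at h2
  have h3 := mul_le_mul_of_nonneg_left h1 (norm_nonneg x)
  have h4 := inner_le_supportFn hz x
  rw [inner_sub_right] at h2
  linarith

theorem continuous_supportFn {n : ℕ} (x : E n) :
    Continuous fun K : ConvexBody (E n) => supportFn K x := by
  refine (LipschitzWith.of_le_add_mul ‖x‖₊ fun K L => ?_).continuous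
  simpa using supportFn_le_add_dist K L x

theorem IsOSymm.neg_mem {n : ℕ} {K : ConvexBody (E n)} (hK : IsOSymm K) {y : E n}
    (hy : y ∈ (K : Set (E n))) : -y ∈ (K : Set (E n)) := by
  rw [← hK]
  simpa using hy

theorem IsOSymm.supportFn_neg {n : ℕ} {K : ConvexBody (E n)} (hK : IsOSymm K) (x : E n) :
    supportFn K (-x) = supportFn K x := by
  have key : ∀ x, supportFn K (-x) ≤ supportFn K x := fun x => supportFn_le fun y hy => by
    rw [inner_neg_left, ← inner_neg_right]
    exact inner_le_supportFn (hK.neg_mem hy) x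
  exact (key x).antisymm (by simpa using key (-x))

theorem IsOSymm.supportFn_smul {n : ℕ} {K : ConvexBody (E n)} (hK : IsOSymm K) (c : ℝ) (x : E n) :
    supportFn K (c • x) = |c| * supportFn K x := by
  rcases le_total 0 c with h | h
  · rw [_root_.supportFn_smul K h, abs_of_nonneg h]
  · rw [← hK.supportFn_neg, ← neg_smul, _root_.supportFn_smul K (neg_nonneg.2 h), abs_of_nonpos h]

theorem IsOSymm.supportFn_nonneg {n : ℕ} {K : ConvexBody (E n)} (hK : IsOSymm K) (x : E n) :
    0 ≤ supportFn K x := by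
  have h := supportFn_add_le K x (-x)
  have h0 : supportFn K (0 : E n) = 0 := by simpa using _root_.supportFn_smul K le_rfl (0 : E n)
  rw [hK.supportFn_neg, add_neg_cancel, h0] at h
  linarith

/-- The segment `[-u, u]`. -/
noncomputable def symmSegment {n : ℕ} (u : E n) : SymmZonoid n :=
  ⟨segmentBody (-u) u, subset_closure ⟨1, fun _ => -u, fun _ => u, by simp⟩, by
    change -segment ℝ (-u) u = segment ℝ (-u) u
    rw [← Set.image_neg_eq_neg]
    have := image_segment ℝ (-LinearMap.id : E n →ₗ[ℝ] E n).toAffineMap (-u) u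
    simpa [segment_symm] using this⟩

theorem supportFn_symmSegment {n : ℕ} (u x : E n) :
    supportFn (symmSegment u).1 x = |inner ℝ x u| := by
  rw [symmSegment, supportFn_segmentBody, inner_neg_right, max_comm]
  rfl

/-! ### Reduction to a function of two real variables -/

namespace ProjectionCovariant

variable {n : ℕ} {op : SymmZonoid n → SymmZonoid n → SymmZonoid n}

theorem supportFn_starProjection_span (K : SymmZonoid n) (x y : E n) :
    supportFn K.1 ((ℝ ∙ x).starProjection y) = |inner ℝ x y / ‖x‖ ^ 2| * supportFn K.1 x := by
  rw [Submodule.starProjection_singleton, K.2.2.supportFn_smul]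
  rfl

/-- An o-symmetric set projects onto a line as a symmetric segment, which one support value
determines. -/
theorem proj_span_eq {K K' : SymmZonoid n} {x : E n}
    (h : supportFn K.1 x = supportFn K'.1 x) :
    SymmZonoid.proj (ℝ ∙ x) K = SymmZonoid.proj (ℝ ∙ x) K' := by
  refine Subtype.ext (supportFn_injective fun y _ => ?_)
  rw [supportFn_starProjection, supportFn_starProjection, supportFn_starProjection_span,
    supportFn_starProjection_span, h]

/-- The value of the support function of `op K L` at `x` is determined by those of `K` and `L`. -/
theorem supportFn_congr (hop : ProjectionCovariant op) (hn : 1 < n) {K K' L L' : SymmZonoid n}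
    {x : E n} (hx : x ≠ 0) (hK : supportFn K.1 x = supportFn K'.1 x)
    (hL : supportFn L.1 x = supportFn L'.1 x) :
    supportFn (op K L).1 x = supportFn (op K' L').1 x := by
  have h1 : Module.finrank ℝ (ℝ ∙ x) = 1 := finrank_span_singleton hx
  have key : ∀ K L, supportFn (op K L).1 x =
      supportFn (op (SymmZonoid.proj (ℝ ∙ x) K) (SymmZonoid.proj (ℝ ∙ x) L)).1 x := fun K L => by
    rw [← hop _ h1.ge (h1 ▸ hn), supportFn_starProjection,
      Submodule.starProjection_eq_self_iff.2 (Submodule.mem_span_singleton_self x)]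
  rw [key, key K', proj_span_eq hK, proj_span_eq hL]

theorem proj_symmSegment (u : E n) (s : ℝ) :
    SymmZonoid.proj (ℝ ∙ u) (symmSegment (s • u)) = symmSegment (s • u) := by
  refine Subtype.ext (supportFn_injective fun y _ => ?_)
  rw [supportFn_starProjection, supportFn_symmSegment, supportFn_symmSegment,
    Submodule.inner_starProjection_left_eq_right,
    Submodule.starProjection_eq_self_iff.2
      (Submodule.smul_mem _ _ (Submodule.mem_span_singleton_self u))]

/-- The coefficient `c` for which `op [-su, su] [-tu, tu] = [-cu, cu]`. -/
noncomputable def coeff (op : SymmZonoid n → SymmZonoid n → SymmZonoid n) (u : E n) (s t : ℝ) : ℝ :=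
  supportFn (op (symmSegment (s • u)) (symmSegment (t • u))).1 u / ‖u‖ ^ 2

/-- Both segments are fixed by projection onto the line of u, hence so is the result of the
operation. -/
theorem supportFn_op_symmSegment (hop : ProjectionCovariant op) (hn : 1 < n) {u : E n}
    (hu : u ≠ 0) (s t : ℝ) (x : E n) :
    supportFn (op (symmSegment (s • u)) (symmSegment (t • u))).1 x =
      |inner ℝ u x| * coeff op u s t := by
  have h1 : Module.finrank ℝ (ℝ ∙ u) = 1 := finrank_span_singleton hu
  rw [← proj_symmSegment u s, ← proj_symmSegment u t, ← hop _ h1.ge (h1 ▸ hn),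
    supportFn_starProjection, supportFn_starProjection_span, coeff, abs_div, abs_pow, abs_norm]
  ring

theorem supportFn_op_eq_coeff (hop : ProjectionCovariant op) (hn : 1 < n) {u x : E n}
    (hux : inner ℝ u x = 1) (K L : SymmZonoid n) :
    supportFn (op K L).1 x = coeff op u (supportFn K.1 x) (supportFn L.1 x) := by
  have hx : x ≠ 0 := by rintro rfl; simp at hux
  have hu : u ≠ 0 := by rintro rfl; simp at hux
  have key : ∀ K : SymmZonoid n,
      supportFn K.1 x = supportFn (symmSegment (supportFn K.1 x • u)).1 x := fun K => by
    rw [supportFn_symmSegment, inner_smul_right, real_inner_comm, hux, mul_one,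
      abs_of_nonneg (K.2.2.supportFn_nonneg x)]
  rw [hop.supportFn_congr hn hx (key K) (key L), hop.supportFn_op_symmSegment hn hu, hux]
  simp

/-- Cramer's rule for the Gram system in span {x, y}; its determinant is nonzero by strict
Cauchy–Schwarz. -/
theorem exists_inner_eq_one {x y : E n} (h : LinearIndependent ℝ ![x, y]) :
    ∃ u : E n, inner ℝ u x = 1 ∧ inner ℝ u y = 1 := by
  have hx : x ≠ 0 := h.ne_zero 0
  have hD : ‖x‖ ^ 2 * ‖y‖ ^ 2 - inner ℝ x y ^ 2 ≠ 0 := by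
    intro h0
    have h1 : |inner ℝ x y| = ‖x‖ * ‖y‖ := by
      rw [← abs_of_nonneg (by positivity : 0 ≤ ‖x‖ * ‖y‖), ← sq_eq_sq_iff_abs_eq_abs]
      linarith
    have h2 := (norm_inner_eq_norm_tfae ℝ x y).out 0 2
    obtain h3 | ⟨r, rfl⟩ := h2.1 h1
    · exact hx h3
    · have := (LinearIndependent.pair_iff.1 h) r (-1) (by simp)
      norm_num at this
  refine ⟨(‖x‖ ^ 2 * ‖y‖ ^ 2 - inner ℝ x y ^ 2)⁻¹ •
    ((‖y‖ ^ 2 - inner ℝ x y) • x + (‖x‖ ^ 2 - inner ℝ x y) • y), ?_, ?_⟩ <;>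
  · simp only [real_inner_smul_left, inner_add_left, real_inner_self_eq_norm_sq,
      real_inner_comm x y]
    rw [inv_mul_eq_one₀ hD]
    ring

theorem coeff_congr (hop : ProjectionCovariant op) (hn : 1 < n) {u v x : E n}
    (hu : inner ℝ u x = 1) (hv : inner ℝ v x = 1) {s t : ℝ} (hs : 0 ≤ s) (ht : 0 ≤ t) :
    coeff op u s t = coeff op v s t := by
  have key : ∀ s, 0 ≤ s → supportFn (symmSegment (s • u)).1 x = s := fun s hs => by
    rw [supportFn_symmSegment, inner_smul_right, real_inner_comm, hu, mul_one, abs_of_nonneg hs]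
  have h1 := hop.supportFn_op_eq_coeff hn hu (symmSegment (s • u)) (symmSegment (t • u))
  have h2 := hop.supportFn_op_eq_coeff hn hv (symmSegment (s • u)) (symmSegment (t • u))
  rw [h1, key s hs, key t ht] at h2
  exact h2

/-- A projection covariant operation acts on support functions by a positively homogeneous
function of two variables. -/
theorem exists_supportFn_op (hop : ProjectionCovariant op) (hn : 1 < n) :
    ∃ F : ℝ → ℝ → ℝ,
      (∀ K L x, x ≠ 0 → supportFn (op K L).1 x = F (supportFn K.1 x) (supportFn L.1 x)) ∧
      ∀ c s t, 0 < c → 0 ≤ s → 0 ≤ t → F (c * s) (c * t) = c * F s t := by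
  set e : E n := EuclideanSpace.single ⟨0, by lia⟩ 1 with he
  set e' : E n := EuclideanSpace.single ⟨1, hn⟩ 1 with he'
  have hee : inner ℝ e e = 1 := by simp [he]
  have hee' : inner ℝ e e' = 0 := (EuclideanSpace.orthonormal_single (𝕜 := ℝ)).2 (by simp)
  have hee'' : inner ℝ e' e' = 1 := by simp [he']
  have hF : ∀ K L x, x ≠ 0 →
      supportFn (op K L).1 x = coeff op e (supportFn K.1 x) (supportFn L.1 x) := by
    intro K L x hx
    -- `coeff_congr` compares only vectors having product 1 with a common point; y links e to some u
    -- with ⟨u, x⟩ = 1. If x is parallel to e, then e + e' serves as y.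
    have hy : ∃ y, inner ℝ e y = 1 ∧ LinearIndependent ℝ ![x, y] := by
      by_cases h : LinearIndependent ℝ ![x, e]
      · exact ⟨e, hee, h⟩
      · rw [LinearIndependent.pair_iff' hx] at h
        push Not at h
        obtain ⟨c, hc⟩ := h
        refine ⟨e + e', by rw [inner_add_right, hee, hee', add_zero], ?_⟩
        rw [LinearIndependent.pair_iff' hx]
        intro d hd
        have hc0 : c ≠ 0 := by
          rintro rfl
          rw [← hc] at hee
          simp at hee
        have hxe : x = c⁻¹ • e := by rw [← hc, smul_smul, inv_mul_cancel₀ hc0, one_smul]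
        have := congrArg (inner ℝ e') hd
        rw [hxe, inner_smul_right, inner_smul_right, inner_add_right, real_inner_comm, hee',
          hee''] at this
        norm_num at this
    obtain ⟨y, hey, hxy⟩ := hy
    obtain ⟨u, hux, huy⟩ := exists_inner_eq_one hxy
    rw [hop.supportFn_op_eq_coeff hn hux]
    exact hop.coeff_congr hn huy hey (K.2.2.supportFn_nonneg x) (L.2.2.supportFn_nonneg x)
  refine ⟨coeff op e, hF, fun c s t hc hs ht => ?_⟩
  have he0 : e ≠ 0 := by intro h; simp [h] at hee
  have h1 := hF (symmSegment (s • e)) (symmSegment (t • e)) (c • e) (smul_ne_zero hc.ne' he0)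
  rw [hop.supportFn_op_symmSegment hn he0, supportFn_symmSegment, supportFn_symmSegment] at h1
  simp only [inner_smul_right, real_inner_smul_left, hee, mul_one, abs_mul, abs_of_pos hc,
    abs_of_nonneg hs, abs_of_nonneg ht] at h1
  rw [mul_comm c s, mul_comm c t]
  exact h1.symm

end ProjectionCovariant

/-! ### A second-difference inequality for zonoids -/

/-- Among the indices at which both `|c|` is large and `|s k * b + c|` is small on the scale of
`q ^ k`, at most two survive. -/
theorem sum_pos_part_le {M : ℕ} {s : ℕ → ℝ} {q R : ℝ} (hs : ∀ i j, i < j → 1 ≤ s j - s i)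
    (hs0 : ∀ i, 0 ≤ s i) (hR : ∀ k < M, s k ≤ R) (hq1 : 1 ≤ q) (hq : M * (1 + 2 * R) ≤ q)
    (a b c : ℝ) :
    ∑ k ∈ Finset.range M,
      (max |a| |q ^ k * (s k * b + c)| - |q ^ k * (s k * b + c)|
        - (max |a| |q ^ k * c| - |q ^ k * c|)) ≤ 3 * |a| := by
  classical
  rcases Nat.eq_zero_or_pos M with rfl | hM
  · simp
  set A := |a| with hA
  have hA0 : 0 ≤ A := abs_nonneg a
  have hM' : (0 : ℝ) < M := by exact_mod_cast hM
  have hq0 : 0 < q := by linarith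
  set T := (Finset.range M).filter
    fun k => A < M * |q ^ k * c| ∧ |q ^ k * (s k * b + c)| < A with hT
  -- Smallness at j and k bounds b, as s separates them, and then c, at scale q ^ j. Descending to
  -- scale q ^ i gains a factor q, so |q ^ i * c| ≤ A / M, against i ∈ T.
  have hno : ∀ i ∈ T, ∀ j ∈ T, ∀ k ∈ T, i < j → j < k → False := by
    intro i hi j hj k hk hij hjk
    simp only [hT, Finset.mem_filter, Finset.mem_range, abs_mul, abs_of_pos (pow_pos hq0 _)]
      at hi hj hk
    have hqij : q * q ^ i ≤ q ^ j := by
      rw [← pow_succ']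
      exact pow_le_pow_right₀ hq1 hij
    have hqjk : q ^ j ≤ q ^ k := pow_le_pow_right₀ hq1 hjk.le
    have hqi := pow_pos hq0 i
    have hqj := pow_pos hq0 j
    have hjk' : q ^ j * |s k * b + c| ≤ A :=
      (mul_le_mul_of_nonneg_right hqjk (abs_nonneg _)).trans hk.2.2.le
    have hb : q ^ j * |b| ≤ 2 * A := by
      have h1 : |b| ≤ |s k * b + c| + |s j * b + c| := by
        have h2 : |(s k - s j) * b| ≤ |s k * b + c| + |s j * b + c| := by
          have := abs_sub (s k * b + c) (s j * b + c)
          rwa [show s k * b + c - (s j * b + c) = (s k - s j) * b by ring] at this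
        rw [abs_mul] at h2
        have h3 : (1 : ℝ) ≤ |s k - s j| := (hs j k hjk).trans (le_abs_self _)
        nlinarith [abs_nonneg b]
      nlinarith [hj.2.2]
    have hc : q ^ j * |c| ≤ (1 + 2 * R) * A := by
      have h1 : |c| ≤ |s j * b + c| + s j * |b| := by
        have := abs_sub (s j * b + c) (s j * b)
        rwa [add_sub_cancel_left, abs_mul (s j), abs_of_nonneg (hs0 j)] at this
      have h2 : s j * (q ^ j * |b|) ≤ R * (2 * A) :=
        mul_le_mul (hR j hj.1) hb (by positivity) ((hs0 j).trans (hR j hj.1))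
      nlinarith [hj.2.2]
    have h1 : q * (q ^ i * |c|) ≤ (1 + 2 * R) * A := by
      refine le_trans ?_ hc
      rw [← mul_assoc]
      exact mul_le_mul_of_nonneg_right hqij (abs_nonneg c)
    have h2 : M * (q * (q ^ i * |c|)) ≤ q * A :=
      calc _ ≤ M * ((1 + 2 * R) * A) := mul_le_mul_of_nonneg_left h1 hM'.le
        _ = (M * (1 + 2 * R)) * A := by ring
        _ ≤ q * A := mul_le_mul_of_nonneg_right hq hA0
    nlinarith [hi.2.1]
  have hcard : T.card ≤ 2 := by
    rcases T.eq_empty_or_nonempty with h | h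
    · simp [h]
    · refine (Finset.card_le_card (t := {T.min' h, T.max' h}) fun j hj => ?_).trans
        Finset.card_le_two
      by_contra hne
      simp only [Finset.mem_insert, Finset.mem_singleton, not_or] at hne
      exact hno _ (T.min'_mem h) j hj _ (T.max'_mem h)
        (lt_of_le_of_ne (T.min'_le j hj) (Ne.symm hne.1)) (lt_of_le_of_ne (T.le_max' j hj) hne.2)
  -- A term is (A - |q ^ k (s k b + c)|)₊ - (A - |q ^ k c|)₊. Off T either the first part vanishes
  -- or the second is at least A - A / M. The total is A from the M small terms plus 2A from T.
  calc _ ≤ ∑ k ∈ Finset.range M, (A / M + if k ∈ T then A else 0) := by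
        refine Finset.sum_le_sum fun k hk => ?_
        have h0 : 0 ≤ A / M := by positivity
        have h1 := le_max_left A |q ^ k * c|
        have h1' := le_max_right A |q ^ k * c|
        have h2 := abs_nonneg (q ^ k * (s k * b + c))
        have h3 := abs_nonneg (q ^ k * c)
        split_ifs with hkT
        · have : max A |q ^ k * (s k * b + c)| ≤ A + |q ^ k * (s k * b + c)| :=
            max_le (by linarith) (by linarith)
          linarith
        · simp only [hT, Finset.mem_filter, hk, true_and, not_and_or, not_lt] at hkT
          rcases hkT with h | h
          · have : max A |q ^ k * (s k * b + c)| ≤ A + |q ^ k * (s k * b + c)| :=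
              max_le (by linarith) (by linarith)
            have h' : |q ^ k * c| ≤ A / M := by rw [le_div_iff₀ hM']; linarith
            linarith
          · rw [max_eq_right h]
            linarith
    _ ≤ 3 * A := by
        rw [Finset.sum_add_distrib, Finset.sum_ite_mem,
          Finset.inter_eq_right.2 (Finset.filter_subset _ _)]
        simp only [Finset.sum_const, Finset.card_range, nsmul_eq_mul]
        have : (T.card : ℝ) ≤ 2 := by exact_mod_cast hcard
        rw [mul_div_cancel₀ _ hM'.ne']
        nlinarith

theorem abs_add_add_abs_neg_add (a b : ℝ) : |a + b| + |-a + b| = 2 * max |a| |b| := by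
  rcases abs_cases (a + b) with h | h <;> rcases abs_cases (-a + b) with h' | h' <;>
    rcases abs_cases a with h1 | h1 <;> rcases abs_cases b with h2 | h2 <;>
    rcases max_cases |a| |b| with h3 | h3 <;> linarith

/-- A linear inequality between values of functions `x ↦ |⟪x, u⟫|` is inherited by the widths of
zonoids. -/
theorem IsZonoid.nonneg_of_forall_abs_inner {n : ℕ} {K : ConvexBody (E n)} (hK : IsZonoid K)
    (T : (E n → ℝ) →ₗ[ℝ] ℝ) (hT : Continuous T)
    (h : ∀ u : E n, 0 ≤ T fun x => |inner ℝ x u|) :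
    0 ≤ T fun x => supportFn K x + supportFn K (-x) := by
  have hcont : Continuous fun K : ConvexBody (E n) =>
      T fun x => supportFn K x + supportFn K (-x) :=
    hT.comp (continuous_pi fun x => (continuous_supportFn x).add (continuous_supportFn (-x)))
  refine closure_minimal (t := {K | 0 ≤ T fun x => supportFn K x + supportFn K (-x)}) ?_
    (isClosed_le continuous_const hcont) hK
  rintro _ ⟨m, y, z, rfl⟩
  -- The approximating zonotopes need not be centred; widths remove the translations.
  have hw : ∀ s : Finset (Fin m), (fun x => supportFn (∑ i ∈ s, segmentBody (y i) (z i)) x +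
      supportFn (∑ i ∈ s, segmentBody (y i) (z i)) (-x)) =
      ∑ i ∈ s, fun x => |inner ℝ x (z i - y i)| := by
    intro s
    classical
    induction s using Finset.induction_on with
    | empty => ext x; simp [supportFn_zero]
    | insert i s hi ih =>
      rw [Finset.sum_insert hi, Finset.sum_insert hi, ← ih]
      ext x
      simp only [supportFn_add, supportFn_segmentBody, Pi.add_apply, inner_neg_left, inner_sub_right,
        max_neg_neg]
      rw [← max_sub_min_eq_abs]
      ring
  change 0 ≤ T _
  rw [hw, map_sum]
  exact Finset.sum_nonneg fun i _ => h _

theorem IsZonoid.sum_second_differences_le {n : ℕ} {K : ConvexBody (E n)} (hK : IsZonoid K)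
    (hK' : IsOSymm K) {M : ℕ} {s : ℕ → ℝ} {q R : ℝ} (hs : ∀ i j, i < j → 1 ≤ s j - s i)
    (hs0 : ∀ i, 0 ≤ s i) (hR : ∀ k < M, s k ≤ R) (hq1 : 1 ≤ q) (hq : M * (1 + 2 * R) ≤ q)
    (x y z : E n) :
    ∑ k ∈ Finset.range M,
      ((supportFn K (x + q ^ k • (s k • y + z)) + supportFn K (-x + q ^ k • (s k • y + z))
          - 2 * supportFn K (q ^ k • (s k • y + z)))
        - (supportFn K (x + q ^ k • z) + supportFn K (-x + q ^ k • z)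
          - 2 * supportFn K (q ^ k • z))) ≤ 6 * supportFn K x := by
  let ev : E n → (E n → ℝ) →ₗ[ℝ] ℝ := fun v => LinearMap.proj v
  let T : (E n → ℝ) →ₗ[ℝ] ℝ := (6 : ℝ) • ev x - ∑ k ∈ Finset.range M,
    ((ev (x + q ^ k • (s k • y + z)) + ev (-x + q ^ k • (s k • y + z))
        - (2 : ℝ) • ev (q ^ k • (s k • y + z)))
      - (ev (x + q ^ k • z) + ev (-x + q ^ k • z) - (2 : ℝ) • ev (q ^ k • z)))
  have hTf : ∀ f, T f = 6 * f x - ∑ k ∈ Finset.range M,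
      ((f (x + q ^ k • (s k • y + z)) + f (-x + q ^ k • (s k • y + z))
          - 2 * f (q ^ k • (s k • y + z)))
        - (f (x + q ^ k • z) + f (-x + q ^ k • z) - 2 * f (q ^ k • z))) := fun f => by
    simp [T, ev, LinearMap.sum_apply]
  have hT : Continuous T := by
    simp only [funext hTf]
    fun_prop
  have h := hK.nonneg_of_forall_abs_inner T hT fun u => by
    rw [hTf]
    have h := sum_pos_part_le hs hs0 hR hq1 hq (inner ℝ x u) (inner ℝ y u) (inner ℝ z u)
    simp only [inner_add_left, inner_neg_left, real_inner_smul_left, abs_add_add_abs_neg_add]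
    rw [sub_nonneg]
    calc _ = 2 * _ := by
          rw [Finset.mul_sum]
          exact Finset.sum_congr rfl fun k _ => by ring
      _ ≤ 2 * (3 * |inner ℝ x u|) := mul_le_mul_of_nonneg_left h zero_le_two
      _ = _ := by ring
  simp only [hK'.supportFn_neg, ← two_mul] at h
  have h2 : (fun v => 2 * supportFn K v) = (2 : ℝ) • supportFn K := rfl
  rw [h2, map_smul, hTf, smul_eq_mul] at h
  linarith

/-! ### Linearity of the two-variable function -/

/-- Convexity gives the reverse slope inequality, so all chords from 0 have the same slope. -/
theorem ConvexOn.eq_affine_of_slope_le {g : ℝ → ℝ} (hg : ConvexOn ℝ (Set.Ici 0) g)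
    (h : ∀ s t, 0 < s → s < t → (g t - g s) / (t - s) ≤ (g s - g 0) / s) {s : ℝ} (hs : 0 ≤ s) :
    g s = (g 1 - g 0) * s + g 0 := by
  have key : ∀ s t, 0 < s → s < t → (g t - g 0) * s = (g s - g 0) * t := by
    intro s t hs hst
    have h1 := h s t hs hst
    have h2 := hg.slope_mono_adjacent (x := 0) (y := s) (z := t) Set.self_mem_Ici
      (hs.trans hst).le hs hst
    rw [sub_zero] at h2
    have h3 := h1.antisymm h2
    rw [div_eq_div_iff (sub_pos.2 hst).ne' hs.ne'] at h3
    linarith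
  rcases hs.eq_or_lt with rfl | hs
  · simp
  rcases lt_trichotomy s 1 with h | rfl | h
  · linarith [key s 1 hs h]
  · ring
  · linarith [key 1 s one_pos h]

/-- If the support function of a zonoid is `F (|α| + |β|) |γ|` in three directions, then `F` is
linear. -/
theorem SymmZonoid.exists_linear_of_supportFn {n : ℕ} (X : SymmZonoid n) {F : ℝ → ℝ → ℝ}
    (hF : ∀ c s t, 0 < c → 0 ≤ s → 0 ≤ t → F (c * s) (c * t) = c * F s t) {e₀ e₁ e₂ : E n}
    (hX : ∀ α β γ : ℝ, |α| + |β| + |γ| ≠ 0 →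
      supportFn X.1 (α • e₀ + β • e₁ + γ • e₂) = F (|α| + |β|) |γ|) :
    ∃ a b : ℝ, 0 ≤ a ∧ 0 ≤ b ∧ ∀ s t, 0 ≤ s → 0 ≤ t → F s t = a * s + b * t := by
  set h := supportFn X.1 with hh
  set g : ℝ → ℝ := fun s => F s 1 with hg
  have hgh : ∀ s, 0 ≤ s → g s = h (s • e₁ + e₂) := fun s hs => by
    have := hX 0 s 1 (by norm_num; positivity)
    simpa [abs_of_nonneg hs] using this.symm
  have hconv : ConvexOn ℝ (Set.Ici 0) g := by
    refine ⟨convex_Ici 0, fun s hs t ht a b ha hb hab => ?_⟩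
    have hst : 0 ≤ a • s + b • t := add_nonneg (mul_nonneg ha hs) (mul_nonneg hb ht)
    rw [hgh s hs, hgh t ht, hgh _ hst, smul_eq_mul, smul_eq_mul, smul_eq_mul, smul_eq_mul, hh,
      ← supportFn_smul X.1 ha, ← supportFn_smul X.1 hb]
    refine le_trans (le_of_eq ?_) (supportFn_add_le X.1 _ _)
    congr 1
    obtain rfl : b = 1 - a := by linarith
    module
  have hval : ∀ l s α : ℝ, 0 < l → 0 ≤ s → |α| = 1 →
      h (α • e₀ + l • (s • e₁ + e₂)) = l * g (s + 1 / l) := by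
    intro l s α hl hs hα
    have h1 := hX α (l * s) l (by rw [hα]; positivity)
    rw [hα, abs_of_nonneg (by positivity), abs_of_pos hl] at h1
    have h2 := hF l (s + 1 / l) 1 hl (by positivity) zero_le_one
    rw [mul_add, mul_one_div_cancel hl.ne', mul_one] at h2
    rw [hg, ← h2, add_comm (l * s), ← h1]
    congr 1
    module
  have hval0 : ∀ l s : ℝ, 0 < l → 0 ≤ s → h (l • (s • e₁ + e₂)) = l * g s := by
    intro l s hl hs
    rw [hh, supportFn_smul _ hl.le, hgh s hs]
  have hslope : ∀ s t, 0 < s → s < t → (g t - g s) / (t - s) ≤ (g s - g 0) / s := by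
    intro s t hs hst
    set σ := (g t - g s) / (t - s)
    set τ := (g s - g 0) / s
    have hM : ∀ M : ℕ, M * (σ - τ) ≤ 3 * h e₀ := by
      intro M
      -- Unit spacing meets the separation hypothesis; starting beyond t makes the slopes of g there
      -- at least σ.
      set r : ℕ → ℝ := fun k => t + 1 + k with hr
      have hr0 : ∀ k, 0 ≤ r k := fun k => by have := hs.trans hst; positivity
      obtain ⟨q, hq1, hq⟩ : ∃ q : ℝ, 1 ≤ q ∧ M * (1 + 2 * (t + 1 + M)) ≤ q :=
        ⟨_, le_max_left 1 (M * (1 + 2 * (t + 1 + M))), le_max_right _ _⟩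
      have h1 := X.2.1.sum_second_differences_le X.2.2 (M := M) (s := r) (R := t + 1 + M)
        (fun i j hij => by
          have : ((i + 1 : ℕ) : ℝ) ≤ j := by exact_mod_cast hij
          push_cast at this
          simp only [hr]; linarith)
        hr0
        (fun k hk => by
          have : (k : ℝ) ≤ M := by exact_mod_cast hk.le
          simp only [hr]; linarith) hq1 hq e₀ (s⁻¹ • e₁) (s⁻¹ • e₂)
      have h2 : ∑ k ∈ Finset.range M, 2 * (σ - τ) ≤ 6 * h e₀ := by
        refine le_trans (Finset.sum_le_sum fun k _ => ?_) h1
        -- The factor s⁻¹ in both directions gives 1 / l ≤ s, so the slope of g on [0, 1 / l] is at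
        -- most τ.
        set l := q ^ k * s⁻¹ with hl
        have hq0 : 1 ≤ q ^ k := one_le_pow₀ hq1
        have hl0 : 0 < l := by positivity
        have hls : 1 / l ≤ s := by
          rw [div_le_iff₀ hl0, hl, mul_comm, mul_assoc, inv_mul_cancel₀ hs.ne']
          linarith
        have e1 : q ^ k • (r k • s⁻¹ • e₁ + s⁻¹ • e₂) = l • (r k • e₁ + e₂) := by module
        have e2 : q ^ k • s⁻¹ • e₂ = l • ((0 : ℝ) • e₁ + e₂) := by module
        have e3 : ∀ v, e₀ + v = (1 : ℝ) • e₀ + v := fun v => by module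
        have e4 : ∀ v, -e₀ + v = (-1 : ℝ) • e₀ + v := fun v => by module
        rw [e1, e2, e3, e4, e3, e4, ← hh, hval _ _ _ hl0 (hr0 k) (by simp),
          hval _ _ _ hl0 (hr0 k) (by simp), hval0 _ _ hl0 (hr0 k),
          hval _ _ _ hl0 le_rfl (by simp), hval _ _ _ hl0 le_rfl (by simp),
          hval0 _ _ hl0 le_rfl, zero_add]
        have htr : t < r k := by simp only [hr]; have : (0 : ℝ) ≤ k := k.cast_nonneg; linarith
        have hinv : 0 < 1 / l := by positivity
        have h3 : σ ≤ l * (g (r k + 1 / l) - g (r k)) := by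
          have h4 := hconv.slope_mono_adjacent (x := s) (y := t) (z := r k) hs.le (hr0 k) hst htr
          have h5 := hconv.slope_mono_adjacent (x := t) (y := r k) (z := r k + 1 / l)
            (hs.trans hst).le (add_nonneg (hr0 k) hinv.le) htr (by linarith)
          rw [add_sub_cancel_left, div_div_eq_mul_div, div_one, mul_comm _ l] at h5
          exact h4.trans h5
        have h6 : l * (g (1 / l) - g 0) ≤ τ := by
          have h7 := hconv.secant_mono (a := 0) (x := 1 / l) (y := s) Set.self_mem_Ici hinv.le hs.le
            hinv.ne' hs.ne' hls
          rwa [sub_zero, sub_zero, div_div_eq_mul_div, div_one, mul_comm _ l] at h7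
        linarith
      rw [Finset.sum_const, Finset.card_range, nsmul_eq_mul] at h2
      linarith
    by_contra hlt
    rw [not_le, ← sub_pos] at hlt
    obtain ⟨M, hM'⟩ := exists_nat_gt (3 * h e₀ / (σ - τ))
    rw [div_lt_iff₀ hlt] at hM'
    exact absurd (hM M) (not_le.2 hM')
  set a := g 1 - g 0 with ha
  set b := g 0 with hb
  have haff : ∀ s, 0 ≤ s → g s = a * s + b := fun s hs => hconv.eq_affine_of_slope_le hslope hs
  have hpos : ∀ s t, 0 ≤ s → 0 < t → F s t = a * s + b * t := by
    intro s t hs ht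
    have h1 := hF t (s / t) 1 ht (by positivity) zero_le_one
    rw [mul_div_cancel₀ _ ht.ne', mul_one] at h1
    rw [h1]
    change t * g (s / t) = _
    rw [haff _ (by positivity)]
    field_simp
  have he₀ : F 1 0 = h e₀ := by simpa using (hX 1 0 0 (by simp)).symm
  have he₂ : h e₂ = b := by simpa using hX 0 0 1 (by simp)
  have hb0 : 0 ≤ b := he₂ ▸ X.2.2.supportFn_nonneg e₂
  -- Homogeneity from g does not reach t = 0; subadditivity of h along e₀ + t e₂ supplies this
  -- boundary value.
  have h10 : F 1 0 = a := by
    have h1 : ∀ t, 0 < t → h (e₀ + t • e₂) = a + b * t := fun t ht => by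
      have := hX 1 0 t (by simp; positivity)
      simpa [abs_of_pos ht, hpos 1 t zero_le_one ht] using this
    have h2 : ∀ t, 0 < t → h (t • e₂) = t * b := fun t ht => by
      rw [hh, supportFn_smul _ ht.le, ← hh, he₂]
    rw [he₀]
    apply le_antisymm
    · refine le_of_forall_pos_le_add fun ε hε => ?_
      have ht : 0 < ε / (2 * b + 1) := by positivity
      have h3 := supportFn_add_le X.1 (e₀ + (ε / (2 * b + 1)) • e₂) (-((ε / (2 * b + 1)) • e₂))
      rw [add_neg_cancel_right, X.2.2.supportFn_neg, ← hh, h1 _ ht, h2 _ ht] at h3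
      have h4 : ε / (2 * b + 1) * (2 * b + 1) = ε := div_mul_cancel₀ _ (by positivity)
      nlinarith
    · have h3 := supportFn_add_le X.1 e₀ ((1 : ℝ) • e₂)
      rw [← hh, h1 1 one_pos, h2 1 one_pos] at h3
      linarith
  refine ⟨a, b, h10 ▸ he₀ ▸ X.2.2.supportFn_nonneg e₀, hb0, fun s t hs ht => ?_⟩
  rcases ht.eq_or_lt with rfl | ht
  · rcases hs.eq_or_lt with rfl | hs
    · have := hF 2 0 0 two_pos le_rfl le_rfl
      simp only [mul_zero] at this ⊢
      linarith
    · have := hF s 1 0 hs zero_le_one le_rfl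
      rw [mul_one, mul_zero, h10] at this
      rw [this]
      ring
  · exact hpos s t hs ht

theorem ProjectionCovariant.exists_eq_smul_add_smul {n : ℕ} (hn : 3 ≤ n)
    {op : SymmZonoid n → SymmZonoid n → SymmZonoid n} (hop : ProjectionCovariant op) :
    ∃ a b : ℝ, 0 ≤ a ∧ 0 ≤ b ∧ ∀ K L, (op K L).1 = a • K.1 + b • L.1 := by
  obtain ⟨F, hF, hF'⟩ := hop.exists_supportFn_op (by lia)
  let e : Fin 3 → E n := fun i => EuclideanSpace.single (Fin.castLE hn i) 1
  have he : Orthonormal ℝ e :=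
    (EuclideanSpace.orthonormal_single (𝕜 := ℝ)).comp _ (Fin.castLE_injective hn)
  have hin : ∀ i j, inner ℝ (e i) (e j) = if i = j then (1 : ℝ) else 0 :=
    orthonormal_iff_ite.1 he
  -- The three orthonormal directions used here are where n ≥ 3 enters.
  let K : SymmZonoid n :=
    ⟨(symmSegment (e 0)).1 + (symmSegment (e 1)).1,
      subset_closure ⟨2, ![-e 0, -e 1], ![e 0, e 1], by simp [Fin.sum_univ_two, symmSegment]⟩, by
        rw [IsOSymm, ConvexBody.coe_add, neg_add_rev, add_comm, (symmSegment (e 0)).2.2,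
          (symmSegment (e 1)).2.2]⟩
  obtain ⟨a, b, ha, hb, hab⟩ := (op K (symmSegment (e 2))).exists_linear_of_supportFn
    (F := F) (e₀ := e 0) (e₁ := e 1) (e₂ := e 2) hF' fun α β γ hne => by
      have h0 : α • e 0 + β • e 1 + γ • e 2 ≠ 0 := by
        intro h
        have h' : ∀ i, inner ℝ (e i) (α • e 0 + β • e 1 + γ • e 2) = 0 := fun i => by
          rw [h, inner_zero_right]
        have h0 := h' 0
        have h1 := h' 1
        have h2 := h' 2
        simp only [inner_add_right, inner_smul_right, hin] at h0 h1 h2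
        norm_num [Fin.ext_iff] at h0 h1 h2
        simp [h0, h1, h2] at hne
      rw [hF _ _ _ h0]
      simp only [K, supportFn_add, supportFn_symmSegment, inner_add_left, real_inner_smul_left, hin]
      norm_num [Fin.ext_iff]
  refine ⟨a, b, ha, hb, fun K L => supportFn_injective fun x hx => ?_⟩
  rw [hF K L x hx, hab _ _ (K.2.2.supportFn_nonneg x) (L.2.2.supportFn_nonneg x), supportFn_add,
    supportFn_smul_body ha, supportFn_smul_body hb]

/-! ### Minkowski combinations and limits of linear maps -/

theorem smul_eq_bodyMap {n : ℕ} (c : ℝ) (K : ConvexBody (E n)) :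
    c • K = bodyMap (c • LinearMap.id) K :=
  ConvexBody.ext rfl

theorem bodyMap_smul {n : ℕ} (f : E n →ₗ[ℝ] E n) (c : ℝ) (K : ConvexBody (E n)) :
    bodyMap f (c • K) = c • bodyMap f K :=
  ConvexBody.ext (Set.image_smul_comm f c K fun x => map_smul f c x)

theorem continuous_convexBody_add {n : ℕ} :
    Continuous fun p : ConvexBody (E n) × ConvexBody (E n) => p.1 + p.2 := by
  have key : ∀ K L K' L' : ConvexBody (E n), ∀ p ∈ (K + L : Set (E n)),
      ∃ q ∈ (K' + L' : Set (E n)), dist p q ≤ dist K K' + dist L L' := by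
    rintro K L K' L' _ ⟨x, hx, y, hy, rfl⟩
    obtain ⟨x', hx', hxx⟩ := K'.isCompact.exists_infDist_eq_dist K'.nonempty x
    obtain ⟨y', hy', hyy⟩ := L'.isCompact.exists_infDist_eq_dist L'.nonempty y
    refine ⟨x' + y', ⟨x', hx', y', hy', rfl⟩, (dist_add_add_le _ _ _ _).trans (add_le_add ?_ ?_)⟩
    · rw [← hxx]
      exact Metric.infDist_le_hausdorffDist_of_mem hx ConvexBody.hausdorffEDist_ne_top
    · rw [← hyy]
      exact Metric.infDist_le_hausdorffDist_of_mem hy ConvexBody.hausdorffEDist_ne_top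
  refine (LipschitzWith.of_dist_le_mul (K := 2) fun p q => ?_).continuous
  have h1 : dist p.1 q.1 ≤ dist p q := le_max_left _ _
  have h2 : dist p.2 q.2 ≤ dist p q := le_max_right _ _
  have h3 : dist (p.1 + p.2) (q.1 + q.2) ≤ dist p.1 q.1 + dist p.2 q.2 := by
    refine Metric.hausdorffDist_le_of_mem_dist (by positivity) (key p.1 p.2 q.1 q.2) ?_
    rw [dist_comm p.1, dist_comm p.2]
    exact key q.1 q.2 p.1 p.2
  push_cast
  linarith

theorem dist_bodyMap_le {n : ℕ} {f g : E n →ₗ[ℝ] E n} {K : ConvexBody (E n)} {r : ℝ}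
    (h : ∀ x ∈ (K : Set (E n)), dist (f x) (g x) ≤ r) : dist (bodyMap f K) (bodyMap g K) ≤ r := by
  obtain ⟨x, hx⟩ := K.nonempty
  refine Metric.hausdorffDist_le_of_mem_dist (dist_nonneg.trans (h x hx)) ?_ ?_
  · rintro _ ⟨y, hy, rfl⟩
    exact ⟨g y, ⟨y, hy, rfl⟩, h y hy⟩
  · rintro _ ⟨y, hy, rfl⟩
    exact ⟨f y, ⟨y, hy, rfl⟩, dist_comm (f y) (g y) ▸ h y hy⟩

theorem SymmZonoid.map_op {n : ℕ} {op : SymmZonoid n → SymmZonoid n → SymmZonoid n} {a b : ℝ}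
    (h : ∀ K L, (op K L).1 = a • K.1 + b • L.1) (f : E n →ₗ[ℝ] E n) (K L : SymmZonoid n) :
    SymmZonoid.map f (op K L) = op (SymmZonoid.map f K) (SymmZonoid.map f L) := by
  refine Subtype.ext ?_
  rw [h]
  simp only [SymmZonoid.map, h, bodyMap_add, bodyMap_smul]

theorem hausdorffContinuous_of_eq_smul_add_smul {n : ℕ}
    {op : SymmZonoid n → SymmZonoid n → SymmZonoid n} {a b : ℝ}
    (h : ∀ K L, (op K L).1 = a • K.1 + b • L.1) : HausdorffContinuous op := by
  refine Continuous.subtype_mk (f := fun p : SymmZonoid n × SymmZonoid n => (op p.1 p.2).1) ?_ _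
  simp only [h, smul_eq_bodyMap]
  exact continuous_convexBody_add.comp
    (((continuous_bodyMap _).comp (continuous_subtype_val.comp continuous_fst)).prodMk
      ((continuous_bodyMap _).comp (continuous_subtype_val.comp continuous_snd)))

/-- A projection is a limit of invertible maps. -/
theorem projectionCovariant_of_glCovariant {n : ℕ}
    {op : SymmZonoid n → SymmZonoid n → SymmZonoid n} (hc : HausdorffContinuous op)
    (hg : GLCovariant op) : ProjectionCovariant op := by
  intro S _ _ K L
  let P : E n →ₗ[ℝ] E n := S.starProjection
  have hPP : ∀ x, P (P x) = P x := fun x =>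
    S.starProjection_eq_self_iff.2 (S.starProjection_apply_mem x)
  -- Identity on S and scaling by t on its orthogonal complement: invertible for t > 0, tending to P
  -- as t → 0.
  let f : ℝ → E n →ₗ[ℝ] E n := fun t => P + t • (LinearMap.id - P)
  have hf : ∀ t x, f t x = P x + t • (x - P x) := fun t x => rfl
  have hinj : ∀ t, 0 < t → Function.Injective (f t) := by
    intro t ht
    refine (injective_iff_map_eq_zero (f t)).2 fun x hx => ?_
    have h1 : P x = 0 := by
      have := congrArg P hx
      rwa [hf, map_add, map_smul, map_sub, hPP, sub_self, smul_zero, add_zero, map_zero] at this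
    rw [hf, h1, zero_add, sub_zero] at hx
    exact (smul_eq_zero.1 hx).resolve_left ht.ne'
  have hlim : ∀ X : SymmZonoid n,
      Filter.Tendsto (fun t => SymmZonoid.map (f t) X) (nhdsWithin 0 (Set.Ioi 0))
        (nhds (SymmZonoid.proj S X)) := by
    intro X
    obtain ⟨r, hr⟩ := (X.1.isCompact.image (f := fun x => ‖x - P x‖)
      (by have := P.continuous_of_finiteDimensional; fun_prop)).bddAbove
    rw [tendsto_iff_dist_tendsto_zero]
    refine squeeze_zero' (g := fun t => t * r) (Filter.Eventually.of_forall fun _ => dist_nonneg) ?_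
      ?_
    · filter_upwards [self_mem_nhdsWithin] with t ht
      refine dist_bodyMap_le (f := f t) (g := P) fun x hx => ?_
      rw [hf, dist_eq_norm, add_sub_cancel_left, norm_smul, Real.norm_of_nonneg (le_of_lt ht)]
      exact mul_le_mul_of_nonneg_left (hr ⟨x, hx, rfl⟩) (le_of_lt ht)
    · have : Filter.Tendsto (fun t : ℝ => t * r) (nhds 0) (nhds (0 * r)) :=
        Filter.tendsto_id.mul_const r
      rw [zero_mul] at this
      exact this.mono_left nhdsWithin_le_nhds
  refine tendsto_nhds_unique (hlim (op K L)) ?_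
  refine ((hc.tendsto (SymmZonoid.proj S K, SymmZonoid.proj S L)).comp
    ((hlim K).prodMk_nhds (hlim L))).congr' ?_
  filter_upwards [self_mem_nhdsWithin] with t ht
  exact (hg (LinearEquiv.ofInjectiveEndo (f t) (hinj t ht)) K L).symm

theorem theorem5p1 (n : ℕ) (hn : 3 ≤ n)
    (op : SymmZonoid n → SymmZonoid n → SymmZonoid n) :
    (ProjectionCovariant op ↔ HausdorffContinuous op ∧ GLCovariant op) ∧
    (ProjectionCovariant op ↔
      ∃ a b : ℝ, 0 ≤ a ∧ 0 ≤ b ∧ ∀ K L : SymmZonoid n,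
        ((op K L : ConvexBody (E n)) : Set (E n)) =
          a • ((K : ConvexBody (E n)) : Set (E n)) + b • ((L : ConvexBody (E n)) : Set (E n))) := by
  refine ⟨⟨fun hop => ?_, fun h => projectionCovariant_of_glCovariant h.1 h.2⟩, fun hop => ?_, ?_⟩
  · obtain ⟨a, b, -, -, h⟩ := hop.exists_eq_smul_add_smul hn
    exact ⟨hausdorffContinuous_of_eq_smul_add_smul h, fun φ => SymmZonoid.map_op h φ⟩
  · obtain ⟨a, b, ha, hb, h⟩ := hop.exists_eq_smul_add_smul hn
    exact ⟨a, b, ha, hb, fun K L => by rw [h, ConvexBody.coe_add, ConvexBody.coe_smul,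
      ConvexBody.coe_smul]⟩
  · rintro ⟨a, b, -, -, h⟩ S - -
    exact SymmZonoid.map_op (fun K L => ConvexBody.ext (h K L)) _
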